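/- Let $q$ be a prime power and let $\Pi=\Pi_2(q^2)$ be the desarguesian projective plane over $GF(q^2)$. A *Baer subplane* of $\Pi$ is a set of points and lines of $\Pi$ which, with the incidence of $\Pi$, is a projective plane of order $q$. Let $\Pi'$ be a Baer subplane of $\Pi$, let $P$ be a point of $\Pi'$, and let $l_1,\dots,l_q,l_\infty$ be the $q+1$ lines of $\Pi'$ through $P$ (regarded as lines of $\Pi$). Let $\mathcal F$ be the set of Baer subplanes of $\Pi$ that meet each of $l_1,\dots,l_q,l_\infty$ in $q+1$ points. The sets $B\setminus l_\infty$ with $B\in\mathcal F$ are called affine Baer subplanes, and $\mathcal L_i$ denotes the set of affine segments $(B\setminus l_\infty)\cap l_i$, $B\in\mathcal F$. Let $\mathcal L$ be the set of all $m\cap(l_1\cup\dots\cup l_q)$, where $m$ is a line of $\Pi$ not containing $P$. Let $\Lambda$ be the affine three-space of order $q$ whose points are those of $(l_1\cup\dots\cup l_q)\setminus\{P\}$ and whose lines are the members of $\mathcal L_1\cup\dots\cup\mathcal L_q\cup\mathcal L$. Let $A_1,\dots,A_q$ be mutually disjoint affine Baer subplanes $A_j=B_j\setminus l_\infty$ with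 $B_j\in\mathcal F$, and let $\mathcal S=\{\,l_i\cap A_j : 1\le i,j\le q\,\}$, a set of affine segments which is a parallel class of lines of $\Lambda$. Let $\Theta(\mathcal S)$ be the affine plane of order $q$ whose points are the elements of $\mathcal S$ and whose lines are the sets of $q$ elements of $\mathcal S$ contained in a common plane of $\Lambda$. Let $\mathcal K\subseteq\mathcal S$ be a $k$-arc in $\Theta(\mathcal S)$, that is, a set of $k$ elements of $\mathcal S$ no three of which are on a line of $\Theta(\mathcal S)$. Then the set $K=\bigcup_{S\in\mathcal K}S$ of points contained in the affine segments of $\mathcal K$ is a $kq$-parc in $\Pi$ with respect to the pencil of all lines of $\Pi$ through $P$. That is: $|K|=kq$; for every line $\Psi$ of $\Pi$ through $P$, any two distinct points of $K\cap\Psi$ are independent (so $K\cap\Psi$ is an arc of the projective line $\Psi$); $K\cap\Psi\cap\Psi'=\emptyset$ for any two distinct lines $\Psi,\Psi'$ of $\Pi$ through $P$; and any three distinct points of $K$ that are not all on one line through $P$ are linearly independent, i.e. not collinear. -/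

import Mathlib

open scoped LinearAlgebra.Projectivization

namespace BaerParc

section Incidence

/-- The set of points on a line of an incidence structure. -/
def linePts {P L : Type*} [Membership P L] (m : L) : Set P := {p | p ∈ m}

/-- The incidence relation inherited by a set `X` of points and a set `Y` of lines. -/
abbrev inducedIncidence {P L : Type*} [Membership P L] (X : Set P) (Y : Set L) :
    Membership X Y := ⟨fun m p => (p : P) ∈ (m : L)⟩

/-- The points `X` and lines `Y`, with the inherited incidence, form a projective plane of
order `q`. In a plane of order `q ^ 2` this says that `(X, Y)` is a Baer subplane. -/
def IsSubplaneOfOrder {P L : Type*} [Membership P L] (q : ℕ) (X : Set P) (Y : Set L) : Prop :=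
  letI : Membership X Y := inducedIncidence X Y
  ∃ _ : Configuration.ProjectivePlane X Y, Configuration.ProjectivePlane.order X Y = q

/-- `(X, Y)` is a subplane of order `q`, and `l 1, …, l q, linf` are `q + 1` distinct lines which
are exactly the lines of the subplane through its point `P₀`. -/
structure IsSubplanePencil {P L : Type*} [Membership P L] (q : ℕ) (X : Set P) (Y : Set L)
    (P₀ : P) (l : Fin q → L) (linf : L) : Prop where
  subplane : IsSubplaneOfOrder q X Y
  vertex_mem : P₀ ∈ X
  injective : Function.Injective l
  linf_ne : ∀ i, l i ≠ linf
  pencil : {m | m ∈ Y ∧ P₀ ∈ m} = insert linf (Set.range l)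

/-- The family `ℱ` of (point sets of) subplanes of order `q` which meet each of
`l 1, …, l q, linf` in `q + 1` points. -/
def baerFamily {P L : Type*} [Membership P L] (q : ℕ) (l : Fin q → L) (linf : L) :
    Set (Set P) :=
  {B | (∃ Y : Set L, IsSubplaneOfOrder q B Y) ∧
    (∀ i, (B ∩ linePts (l i)).ncard = q + 1) ∧ (B ∩ linePts linf).ncard = q + 1}

/-- The affine Baer subplanes `B \ linf`, for `B` in the family `ℱ`. -/
def affineBaerFamily {P L : Type*} [Membership P L] (q : ℕ) (l : Fin q → L) (linf : L) :
    Set (Set P) :=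
  {A | ∃ B ∈ baerFamily q l linf, A = B \ linePts linf}

/-- The set `ℒᵢ` of affine segments cut on `l i` by the affine Baer subplanes of the family. -/
def pencilSegments {P L : Type*} [Membership P L] (q : ℕ) (l : Fin q → L) (linf : L)
    (i : Fin q) : Set (Set P) :=
  {s | ∃ A ∈ affineBaerFamily q l linf, s = A ∩ linePts (l i)}

/-- The set `ℒ` of affine segments cut on the lines not through `P₀` by `l 1, …, l q`. -/
def transversalSegments {P L : Type*} [Membership P L] {q : ℕ} (P₀ : P) (l : Fin q → L) :
    Set (Set P) :=
  {s | ∃ m : L, P₀ ∉ m ∧ s = linePts m ∩ ⋃ i, linePts (l i)}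

/-- The points of the affine three-space `Λ`. -/
def spacePoints {P L : Type*} [Membership P L] {q : ℕ} (P₀ : P) (l : Fin q → L) : Set P :=
  (⋃ i, linePts (l i)) \ {P₀}

/-- The lines of the affine three-space `Λ`, as sets of points. -/
def spaceLines {P L : Type*} [Membership P L] (q : ℕ) (P₀ : P) (l : Fin q → L) (linf : L) :
    Set (Set P) :=
  (⋃ i, pencilSegments q l linf i) ∪ transversalSegments P₀ l

/-- A flat of `Λ`: a set of points of `Λ` that contains every line of `Λ` which it meets in at
least two points. -/
def IsSpaceFlat {P L : Type*} [Membership P L] (q : ℕ) (P₀ : P) (l : Fin q → L) (linf : L)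
    (U : Set P) : Prop :=
  U ⊆ spacePoints P₀ l ∧
    ∀ s ∈ spaceLines q P₀ l linf, ∀ x ∈ s ∩ U, ∀ y ∈ s ∩ U, x ≠ y → s ⊆ U

/-- The set `𝒮` of affine segments `l i ∩ A j`; these are the points of `Θ(𝒮)`. -/
def thetaPoints {P L : Type*} [Membership P L] {q : ℕ} (l : Fin q → L) (A : Fin q → Set P) :
    Set (Set P) :=
  {s | ∃ i j, s = linePts (l i) ∩ A j}

/-- The lines of `Θ(𝒮)`: the sets of segments of `𝒮` contained in a plane of `Λ` that contains `q`
segments of `𝒮`. The planes of the affine space `Λ` of order `q` are its flats with `q ^ 2` points.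
(When `q = 2` lines have two points and every four-point set is a flat in this sense, but a
four-point set which contains two of the four members of the parallel class `𝒮` is their union,
which is a plane, so the lines of `Θ(𝒮)` are the right ones also in that case.) -/
def thetaLines {P L : Type*} [Membership P L] (q : ℕ) (P₀ : P) (l : Fin q → L) (linf : L)
    (A : Fin q → Set P) : Set (Set (Set P)) :=
  {T | ∃ U : Set P, IsSpaceFlat q P₀ l linf U ∧ U.ncard = q ^ 2 ∧
    T = {s | s ∈ thetaPoints l A ∧ s ⊆ U} ∧ T.ncard = q}

/-- In an incidence structure with point set `S` and line set `T` (lines being sets of points),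
`K` is a `k`-arc: a set of `k` points, no three of which are on a line. -/
def IsPlaneArc {α : Type*} (S : Set α) (T : Set (Set α)) (k : ℕ) (K : Set α) : Prop :=
  K ⊆ S ∧ K.ncard = k ∧
    ∀ a ∈ K, ∀ b ∈ K, ∀ c ∈ K, a ≠ b → a ≠ c → b ≠ c →
      ∀ t ∈ T, ¬ (a ∈ t ∧ b ∈ t ∧ c ∈ t)

end Incidence

section ParcDefs

/-- Any `t` distinct points of `S` are linearly independent. -/
def IsIndepSet {F V : Type*} [Field F] [AddCommGroup V] [Module F V] (t : ℕ)
    (S : Set (ℙ F V)) : Prop :=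
  ∀ f : Fin t → ℙ F V, Function.Injective f → (∀ i, f i ∈ S) → Projectivization.Independent f

/-- `K` is a `k`-parc in the projective plane over `F` with respect to the pencil of all lines
through the point `P₀`. Lines are given by their homogeneous coordinates: `p ∈ m` means that `p`
and `m` are orthogonal. -/
structure IsPencilArc {F : Type*} [Field F] (P₀ : ℙ F (Fin 3 → F)) (k : ℕ)
    (K : Set (ℙ F (Fin 3 → F))) : Prop where
  ncard_eq : K.ncard = k
  /-- The points of `K` on a line of the pencil form an arc of that projective line. -/
  arc : ∀ m : ℙ F (Fin 3 → F), P₀ ∈ m → IsIndepSet 2 (K ∩ linePts m)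
  /-- No point of `K` is on two lines of the pencil. -/
  disjoint : ∀ m n : ℙ F (Fin 3 → F), P₀ ∈ m → P₀ ∈ n → m ≠ n →
    K ∩ linePts m ∩ linePts n = ∅
  /-- Three points of `K` which are not all on one line of the pencil are independent. -/
  indep : ∀ f : Fin 3 → ℙ F (Fin 3 → F), Function.Injective f → (∀ i, f i ∈ K) →
    (¬ ∃ m : ℙ F (Fin 3 → F), P₀ ∈ m ∧ ∀ i, f i ∈ m) → Projectivization.Independent f

end ParcDefs

end BaerParc

/-!
The proof identifies the affine three-space `Λ` in coordinates. A subplane of order `q` that contains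
the standard frame consists of the points with coordinates in a subfield `T` with `q` elements,
because the sum and product of coordinates are constructed by joining points and intersecting lines
(`IsSubplaneCone.exists_subfield`). Choose coordinates in which `P₀ = (0 : 0 : 1)`, the line `linf` is
`x = 0` and two of the lines `l i` are `y = 0` and `y = x`. Every subplane of the family contains `P₀`,
and a triangular change of coordinates takes it to the standard frame. Hence the lines `l i` are
`y = t i * x` with `T = {t i}`, the same subfield for all the subplanes, so that the points of `Λ` are
the `(1 : y : z)` with `(y, z) ∈ T × F`, and the affine Baer subplanes are planes
`z ∈ a + b * y + c * T` of this affine space over `T` (`exists_pencilCoordinates`).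

As `F` has dimension two over `T`, disjointness of the planes `A j` forces all the directions `c * T`
to coincide (`exists_isParallelClass`), and by counting the `A j` cover `Λ`. If three points of the
union of the arc were on a line `m` that is not in the pencil, with equation `z = α + β * y`, they
would be in three distinct segments, since a segment is on a line `l i`, which meets `m` only once.
These segments would be in the plane `z ∈ α + β * y + c * T`, which is a flat of `Λ`
(`isSpaceFlat_affinePlane`) containing exactly one segment on each `l i`; so they would be on a line
of `Θ(𝒮)` (`setOf_subset_affinePlane_mem_thetaLines`), contradicting the arc property.
-/

namespace BaerParc

open Projectivization

/-! ### Points of a subplane as a cone of vectors -/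

section Cones

open Matrix

variable {F : Type*} [Field F]

theorem det_rows_eq_zero_iff {p r s : Fin 3 → F} :
    (Matrix.of ![p, r, s]).det = 0 ↔ ∃ n ≠ 0, p ⬝ᵥ n = 0 ∧ r ⬝ᵥ n = 0 ∧ s ⬝ᵥ n = 0 := by
  rw [← Matrix.exists_mulVec_eq_zero_iff]
  simp only [funext_iff, Matrix.mulVec, Fin.forall_fin_succ, Matrix.of_apply]
  simp

/-- Two independent vectors orthogonal to `n ≠ 0` span all vectors orthogonal to `n`. -/
theorem exists_eq_add_of_dotProduct_eq_zero {p r v n : Fin 3 → F} (hn : n ≠ 0) (hr : r ≠ 0)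
    (hpr : ∀ a : F, a • r ≠ p) (hp' : p ⬝ᵥ n = 0) (hr' : r ⬝ᵥ n = 0) (hv : v ⬝ᵥ n = 0) :
    ∃ a b : F, v = a • p + b • r := by
  have hdet : (Matrix.of ![p, r, v]).det = 0 := det_rows_eq_zero_iff.2 ⟨n, hn, hp', hr', hv⟩
  obtain ⟨w, hw, h⟩ := Matrix.exists_vecMul_eq_zero_iff.2 hdet
  have h' : w 0 • p + w 1 • r + w 2 • v = 0 := by
    rw [← h, Matrix.vecMul_eq_sum, Fin.sum_univ_three]; rfl
  have hw2 : w 2 ≠ 0 := by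
    intro h2
    rw [h2, zero_smul, add_zero] at h'
    by_cases h0 : w 0 = 0
    · rw [h0, zero_smul, zero_add] at h'
      have h1 : w 1 = 0 := (smul_eq_zero.1 h').resolve_right hr
      apply hw
      ext i
      fin_cases i <;> assumption
    · refine hpr (-(w 0)⁻¹ * w 1) ?_
      have : w 0 • p = -(w 1 • r) := eq_neg_of_add_eq_zero_left h'
      calc (-(w 0)⁻¹ * w 1) • r = (w 0)⁻¹ • (-(w 1 • r)) := by module
        _ = p := by rw [← this, smul_smul, inv_mul_cancel₀ h0, one_smul]
  refine ⟨-(w 2)⁻¹ * w 0, -(w 2)⁻¹ * w 1, ?_⟩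
  have : w 2 • v = -(w 0 • p + w 1 • r) := eq_neg_of_add_eq_zero_right h'
  calc v = (w 2)⁻¹ • (w 2 • v) := by rw [smul_smul, inv_mul_cancel₀ hw2, one_smul]
    _ = _ := by rw [this]; module

/-- The nonzero vectors that represent a point of `B`. -/
def cone (B : Set (ℙ F (Fin 3 → F))) : Set (Fin 3 → F) :=
  {v | ∃ h : v ≠ 0, mk F v h ∈ B}

/-- What the representing vectors `C` of the points of a subplane of order `q` satisfy, in a form
that is invariant under linear coordinate changes: `C` is a union of punctured one-dimensional
subspaces, the intersection of two distinct lines spanned by points of `C` is in `C`, and a line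
spanned by two points of `C` has `q` points of `C` besides any one of them. -/
structure IsSubplaneCone (q : ℕ) (C : Set (Fin 3 → F)) : Prop where
  ne_zero : ∀ v ∈ C, v ≠ 0
  smul_mem : ∀ v ∈ C, ∀ a : F, a ≠ 0 → a • v ∈ C
  inter_mem : ∀ p ∈ C, ∀ p' ∈ C, ∀ r ∈ C, ∀ r' ∈ C, (Matrix.of ![p, p', r]).det ≠ 0 →
    ∀ v ≠ 0, ∀ a b c d : F, v = a • p + b • p' → v = c • r + d • r' → v ∈ C
  ncard_line : ∀ p ∈ C, ∀ p' ∈ C, (∀ a : F, a • p' ≠ p) → {t : F | p + t • p' ∈ C}.ncard = q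

/-- Subplane cones are preserved by invertible linear changes of coordinates. -/
theorem IsSubplaneCone.vecMul {q : ℕ} {C : Set (Fin 3 → F)} (hC : IsSubplaneCone q C)
    {M : Matrix (Fin 3) (Fin 3) F} (hM : M.det ≠ 0) :
    IsSubplaneCone q {x | x ᵥ* M ∈ C} := by
  have hinj : ∀ x : Fin 3 → F, x ᵥ* M = 0 → x = 0 := fun x hx => by
    by_contra h
    exact hM (Matrix.exists_vecMul_eq_zero_iff.1 ⟨x, h, hx⟩)
  refine ⟨fun v hv h => hC.ne_zero _ hv (by rw [h, Matrix.zero_vecMul]),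
    fun v hv a ha => ?_, ?_, ?_⟩
  · simpa only [Set.mem_ofPred_eq, Matrix.smul_vecMul] using hC.smul_mem _ hv a ha
  · intro p hp p' hp' r hr r' hr' hdet v hv a b c d h₁ h₂
    refine hC.inter_mem _ hp _ hp' _ hr _ hr' ?_ _ (fun h => hv (hinj _ h)) a b c d ?_ ?_
    · have : Matrix.of ![p ᵥ* M, p' ᵥ* M, r ᵥ* M] = Matrix.of ![p, p', r] * M := by
        ext i j
        fin_cases i <;> rfl
      rw [this, Matrix.det_mul]
      exact mul_ne_zero hdet hM
    · rw [h₁, Matrix.add_vecMul, Matrix.smul_vecMul, Matrix.smul_vecMul]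
    · rw [h₂, Matrix.add_vecMul, Matrix.smul_vecMul, Matrix.smul_vecMul]
  · intro p hp p' hp' h
    simp only [Set.mem_ofPred_eq, Matrix.add_vecMul, Matrix.smul_vecMul]
    refine hC.ncard_line _ hp _ hp' fun a ha => h a ?_
    rw [← sub_eq_zero]
    apply hinj
    rw [Matrix.sub_vecMul, Matrix.smul_vecMul, ha, sub_self]

section Incidence

variable {q : ℕ} {X Y : Set (ℙ F (Fin 3 → F))}

theorem IsSubplaneOfOrder.exists_line (h : IsSubplaneOfOrder q X Y) {x y : ℙ F (Fin 3 → F)}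
    (hx : x ∈ X) (hy : y ∈ X) (hxy : x ≠ y) : ∃ n ∈ Y, x ∈ n ∧ y ∈ n := by
  let _ : Membership X Y := inducedIncidence X Y
  obtain ⟨_, -⟩ := h
  have hne : (⟨x, hx⟩ : X) ≠ ⟨y, hy⟩ := fun h => hxy (congrArg Subtype.val h)
  exact ⟨_, (Configuration.HasLines.mkLine (L := Y) hne).2,
    Configuration.HasLines.mkLine_ax (L := Y) hne⟩

theorem IsSubplaneOfOrder.exists_point (h : IsSubplaneOfOrder q X Y) {m n : ℙ F (Fin 3 → F)}
    (hm : m ∈ Y) (hn : n ∈ Y) (hmn : m ≠ n) : ∃ x ∈ X, x ∈ m ∧ x ∈ n := by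
  let _ : Membership X Y := inducedIncidence X Y
  obtain ⟨_, -⟩ := h
  have hne : (⟨m, hm⟩ : Y) ≠ ⟨n, hn⟩ := fun h => hmn (congrArg Subtype.val h)
  exact ⟨_, (Configuration.HasPoints.mkPoint (P := X) hne).2,
    Configuration.HasPoints.mkPoint_ax (P := X) hne⟩

theorem IsSubplaneOfOrder.ncard_inter [Finite F] (h : IsSubplaneOfOrder q X Y)
    {n : ℙ F (Fin 3 → F)} (hn : n ∈ Y) : (X ∩ linePts n).ncard = q + 1 := by
  let _ : Membership X Y := inducedIncidence X Y
  obtain ⟨_, h⟩ := h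
  rw [← h, ← Configuration.ProjectivePlane.pointCount_eq X (⟨n, hn⟩ : Y),
    Configuration.pointCount, ← Nat.card_coe_set_eq]
  exact Nat.card_congr
    { toFun := fun x => ⟨⟨x.1, x.2.1⟩, x.2.2⟩
      invFun := fun x => ⟨x.1.1, x.1.2, x.2⟩
      left_inv := fun _ => rfl
      right_inv := fun _ => rfl }

theorem mem_linePts {P L : Type*} [Membership P L] {x : P} {m : L} : x ∈ linePts m ↔ x ∈ m :=
  Iff.rfl

theorem mk_mem_iff {v n : Fin 3 → F} (hv : v ≠ 0) (hn : n ≠ 0) :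
    mk F v hv ∈ mk F n hn ↔ v ⬝ᵥ n = 0 :=
  orthogonal_mk hv hn

theorem mk_mem_iff_rep {v : Fin 3 → F} (hv : v ≠ 0) (n : ℙ F (Fin 3 → F)) :
    mk F v hv ∈ n ↔ v ⬝ᵥ n.rep = 0 := by
  conv_lhs => rw [← n.mk_rep]
  exact mk_mem_iff hv n.rep_nonzero

theorem IsSubplaneOfOrder.isSubplaneCone [Finite F] (h : IsSubplaneOfOrder q X Y) :
    IsSubplaneCone q (cone X) := by
  have hmk : ∀ (v : Fin 3 → F) (hv : v ≠ 0) (a : F) (h : a • v ≠ 0),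
      mk F (a • v) h = mk F v hv := fun v hv a h => by
    rw [mk_eq_mk_iff']
    exact ⟨a, rfl⟩
  have hsmul : ∀ v ∈ cone X, ∀ a : F, a • v ≠ 0 → a • v ∈ cone X := by
    rintro v ⟨hv, hvX⟩ a ha
    exact ⟨ha, by rwa [hmk v hv a ha]⟩
  refine ⟨fun v hv => hv.1, fun v hv a ha => hsmul v hv a (smul_ne_zero ha hv.1), ?_, ?_⟩
  · rintro p ⟨hp, hpX⟩ p' ⟨hp', hpX'⟩ r ⟨hr, hrX⟩ r' ⟨hr', hrX'⟩ hdet v hv a b c d h₁ h₂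
    by_cases hrr : ∃ e : F, e • r = r'
    · obtain ⟨e, rfl⟩ := hrr
      have : v = (c + d * e) • r := by rw [h₂]; module
      rw [this] at hv ⊢
      exact hsmul r ⟨hr, hrX⟩ _ hv
    have hne : mk F p hp ≠ mk F p' hp' := by
      rw [Ne, mk_eq_mk_iff']
      rintro ⟨e, rfl⟩
      apply hdet
      simp [Matrix.det_fin_three]
      ring
    have hne' : mk F r' hr' ≠ mk F r hr := by
      rwa [Ne, mk_eq_mk_iff']
    obtain ⟨m, hm, hpm, hpm'⟩ := h.exists_line hpX hpX' hne
    obtain ⟨n, hn, hrn', hrn⟩ := h.exists_line hrX' hrX hne'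
    rw [mk_mem_iff_rep] at hpm hpm' hrn hrn'
    have hmn : m ≠ n := by
      rintro rfl
      exact hdet (det_rows_eq_zero_iff.2 ⟨_, m.rep_nonzero, hpm, hpm', hrn⟩)
    obtain ⟨x, hx, hxm, hxn⟩ := h.exists_point hm hn hmn
    have hvm : mk F v hv ∈ m := by rw [mk_mem_iff_rep, h₁]; simp [hpm, hpm']
    have hvn : mk F v hv ∈ n := by rw [mk_mem_iff_rep, h₂]; simp [hrn, hrn']
    refine ⟨hv, ?_⟩
    rwa [(Configuration.Nondegenerate.eq_or_eq hvm hxm hvn hxn).resolve_right hmn]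
  · rintro p ⟨hp, hpX⟩ p' ⟨hp', hpX'⟩ hpp
    have hne : mk F p hp ≠ mk F p' hp' := by
      rw [Ne, mk_eq_mk_iff']
      rintro ⟨e, he⟩
      exact hpp e he
    obtain ⟨m, hm, hpm, hpm'⟩ := h.exists_line hpX hpX' hne
    have hz : ∀ t : F, p + t • p' ≠ 0 := fun t ht => hpp (-t) (by
      rw [neg_smul]; exact (eq_neg_of_add_eq_zero_left ht).symm)
    have hcard := Set.ncard_sdiff_singleton_of_mem (a := mk F p' hp') (s := X ∩ linePts m)
      ⟨hpX', hpm'⟩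
    rw [h.ncard_inter hm, Nat.add_sub_cancel] at hcard
    rw [← hcard]
    rw [mk_mem_iff_rep] at hpm hpm'
    refine Set.ncard_congr (fun t _ => mk F (p + t • p') (hz t)) ?_ ?_ ?_
    · rintro t ⟨ht, htX⟩
      refine ⟨⟨htX, ?_⟩, ?_⟩
      · rw [mem_linePts, mk_mem_iff_rep]
        simp [hpm, hpm']
      · rw [Set.mem_singleton_iff, mk_eq_mk_iff']
        rintro ⟨e, he⟩
        exact hpp (e - t) (by rw [sub_smul, he, add_sub_cancel_right])
    · intro s t _ _ hst
      rw [mk_eq_mk_iff'] at hst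
      obtain ⟨e, he⟩ := hst
      by_contra hne
      by_cases h1 : e = 1
      · subst h1
        rw [one_smul, add_right_inj] at he
        have : (t - s) • p' = 0 := by rw [sub_smul, he, sub_self]
        rcases smul_eq_zero.1 this with h | h
        · exact hne (sub_eq_zero.1 h).symm
        · exact hp' h
      · refine hpp ((e - 1)⁻¹ * (s - e * t)) ?_
        have h2 : (e - 1) • p = (s - e * t) • p' := by
          rw [← sub_eq_zero, ← sub_eq_zero.2 he]; module
        rw [mul_smul, ← h2, smul_smul, inv_mul_cancel₀ (sub_ne_zero.2 h1), one_smul]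
    · rintro x ⟨⟨hxX, hxm⟩, hxp⟩
      induction x with | h v hv =>
      rw [mem_linePts, mk_mem_iff_rep] at hxm
      obtain ⟨a, b, rfl⟩ := exists_eq_add_of_dotProduct_eq_zero m.rep_nonzero hp' hpp hpm hpm' hxm
      have ha : a ≠ 0 := by
        rintro rfl
        apply hxp
        rw [Set.mem_singleton_iff, mk_eq_mk_iff']
        exact ⟨b, by rw [zero_smul, zero_add]⟩
      have : mk F (p + (a⁻¹ * b) • p') (hz _) = mk F (a • p + b • p') hv := by
        rw [mk_eq_mk_iff']
        exact ⟨a⁻¹, by rw [smul_add, smul_smul, smul_smul, inv_mul_cancel₀ ha, one_smul]⟩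
      exact ⟨a⁻¹ * b, ⟨hz _, by rwa [this]⟩, this⟩

end Incidence

end Cones

/-! ### Subplanes in a frame -/

section Frame

open Matrix

variable {F : Type*} [Field F] [Finite F]

/-- A subset of a finite field which contains `0` and `1` and is closed under addition and
multiplication is a subfield. -/
def subfieldOfFinite (T : Set F) (h0 : 0 ∈ T) (h1 : 1 ∈ T)
    (hadd : ∀ x ∈ T, ∀ y ∈ T, x + y ∈ T) (hmul : ∀ x ∈ T, ∀ y ∈ T, x * y ∈ T) : Subfield F where
  carrier := T
  zero_mem' := h0
  one_mem' := h1
  add_mem' := fun hx hy => hadd _ hx _ hy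
  mul_mem' := fun hx hy => hmul _ hx _ hy
  neg_mem' := by
    intro x hx
    obtain ⟨n, hn, hnx⟩ := (isOfFinAddOrder_of_finite x).exists_nsmul_eq_zero
    obtain ⟨m, rfl⟩ := Nat.exists_eq_succ_of_ne_zero hn.ne'
    have hm : ∀ m : ℕ, m • x ∈ T := fun m => by
      induction m with
      | zero => rwa [zero_smul]
      | succ m ih => rw [succ_nsmul]; exact hadd _ ih _ hx
    rw [succ_nsmul] at hnx
    rw [← eq_neg_of_add_eq_zero_left hnx]
    exact hm m
  inv_mem' := by
    intro x hx
    change x⁻¹ ∈ T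
    rcases eq_or_ne x 0 with rfl | hx0
    · rwa [_root_.inv_zero]
    have hpow : ∀ m : ℕ, x ^ m ∈ T := fun m => by
      induction m with
      | zero => rwa [pow_zero]
      | succ m ih => rw [pow_succ]; exact hmul _ ih _ hx
    obtain ⟨n, hn, hnx⟩ := (isOfFinOrder_of_finite (Units.mk0 x hx0)).exists_pow_eq_one
    obtain ⟨m, rfl⟩ := Nat.exists_eq_succ_of_ne_zero hn.ne'
    have h : x ^ m * x = 1 := by
      rw [← pow_succ]
      simpa using congrArg Units.val hnx
    rw [← eq_inv_of_mul_eq_one_left h]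
    exact hpow m

/-- A subplane that contains the standard frame is the one over a subfield: the coordinates of its
points form a subfield because sums and products can be constructed by joining and intersecting. -/
theorem IsSubplaneCone.exists_subfield {q : ℕ} {C : Set (Fin 3 → F)} (hC : IsSubplaneCone q C)
    (h₀ : ![1, 0, 0] ∈ C) (h₁ : ![0, 1, 0] ∈ C) (h₂ : ![0, 0, 1] ∈ C) (h₃ : ![1, 1, 1] ∈ C) :
    ∃ T : Subfield F, (T : Set F).ncard = q ∧ ∀ y z, ![1, y, z] ∈ C ↔ y ∈ T ∧ z ∈ T := by
  have hd : ![0, 1, 1] ∈ C :=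
    hC.inter_mem _ h₁ _ h₂ _ h₀ _ h₃ (by simp [Matrix.det_fin_three]) _ (by simp)
      1 1 (-1) 1 (by simp) (by simp)
  have hy : ∀ y z, ![1, y, z] ∈ C → ![1, y, 0] ∈ C := fun y z h =>
    hC.inter_mem _ h₀ _ h₁ _ h₂ _ h (by simp [Matrix.det_fin_three]) _ (by simp)
      1 y (-z) 1 (by simp) (by simp)
  have hz : ∀ y z, ![1, y, z] ∈ C → ![1, 0, z] ∈ C := fun y z h =>
    hC.inter_mem _ h₀ _ h₂ _ h₁ _ h (by simp [Matrix.det_fin_three]) _ (by simp)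
      1 z (-y) 1 (by simp) (by simp)
  have hyz : ∀ y z, ![1, y, 0] ∈ C → ![1, 0, z] ∈ C → ![1, y, z] ∈ C := fun y z h h' =>
    hC.inter_mem _ h₂ _ h _ h₁ _ h' (by simp [Matrix.det_fin_three]) _ (by simp)
      z 1 y 1 (by simp) (by simp)
  have hswap : ∀ y, ![1, y, 0] ∈ C → ![1, 0, y] ∈ C := fun y h =>
    hz y y <| hC.inter_mem _ h₀ _ hd _ h₂ _ h (by simp [Matrix.det_fin_three]) _ (by simp)
      1 y y 1 (by simp) (by simp)
  have hswap' : ∀ y, ![1, 0, y] ∈ C → ![1, y, 0] ∈ C := fun y h =>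
    hy y y <| hC.inter_mem _ h₀ _ hd _ h₁ _ h (by simp [Matrix.det_fin_three]) _ (by simp)
      1 y y 1 (by simp) (by simp)
  have hmul : ∀ y, ![1, y, 0] ∈ C → ∀ z, ![1, z, 0] ∈ C → ![1, y * z, 0] ∈ C := by
    intro y h z h'
    have hs : ![0, 1, z] ∈ C :=
      hC.inter_mem _ h₁ _ h₂ _ h₀ _ (hyz 1 z (hy _ _ h₃) (hswap z h'))
        (by simp [Matrix.det_fin_three]) _ (by simp) 1 z (-1) 1 (by simp) (by simp)
    refine hswap' _ (hz y _ ?_)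
    exact hC.inter_mem _ h₀ _ hs _ h₂ _ h (by simp [Matrix.det_fin_three]) _ (by simp)
      1 y (y * z) 1 (by simp) (by simp)
  have hadd : ∀ y, ![1, y, 0] ∈ C → ∀ z, ![1, z, 0] ∈ C → ![1, y + z, 0] ∈ C := by
    intro y h z h'
    refine hswap' _ (hz y _ ?_)
    exact hC.inter_mem _ (hswap z h') _ hd _ h₂ _ h (by simp [Matrix.det_fin_three]) _ (by simp)
      1 y (y + z) 1 (by simp [add_comm]) (by simp)
  refine ⟨subfieldOfFinite {y | ![1, y, 0] ∈ C} h₀ (hy _ _ h₃) hadd hmul, ?_, fun y z =>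
    ⟨fun h => ⟨hy _ _ h, hswap' _ (hz _ _ h)⟩, fun h => hyz _ _ h.1 (hswap _ h.2)⟩⟩
  have := hC.ncard_line _ h₀ _ h₁ (by simp)
  simp at this
  exact this

/-- A subplane with the point `(0, 0, 1)` that has affine points on each of `q` lines
`y = t i * x`, in coordinates where two of these are `y = 0` and `y = x`: the parameters `t i` form
a subfield `T`, and the affine points form the plane through `(0, a)` with directions `(1, b)` and
`(0, c)` of the affine space `T × F` over `T`. -/
theorem IsSubplaneCone.exists_affine_eq {q : ℕ} {C : Set (Fin 3 → F)} (hC : IsSubplaneCone q C)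
    {t : Fin q → F} (ht : Function.Injective t) {i₀ i₁ : Fin q} (ht₀ : t i₀ = 0) (ht₁ : t i₁ = 1)
    (h₂ : ![0, 0, 1] ∈ C) {b₀ : F} (hinf : ![0, 1, b₀] ∈ C)
    (hl : ∀ i, ∃ z z', z ≠ z' ∧ ![1, t i, z] ∈ C ∧ ![1, t i, z'] ∈ C) :
    ∃ T : Subfield F, (T : Set F) = Set.range t ∧ ∃ a b c, c ≠ 0 ∧
      ∀ y z, ![1, y, z] ∈ C ↔ y ∈ T ∧ ∃ s ∈ T, z = a + b * y + c * s := by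
  obtain ⟨a, -, -, ha, -⟩ := hl i₀
  obtain ⟨d, d', hdd, hd, hd'⟩ := hl i₁
  rw [ht₀] at ha
  rw [ht₁] at hd hd'
  have hb : ![0, 1, d - a] ∈ C :=
    hC.inter_mem _ h₂ _ hinf _ ha _ hd (by simp [Matrix.det_fin_three]) _ (by simp)
      (d - a - b₀) 1 (-1) 1 (by simp) (by simp [sub_eq_neg_add])
  have hc : d' - d ≠ 0 := sub_ne_zero.2 hdd.symm
  let N : Matrix (Fin 3) (Fin 3) F := Matrix.of ![![1, 0, a], ![0, 1, d - a], ![0, 0, d' - d]]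
  have hN : N.det ≠ 0 := by simpa [N, Matrix.det_fin_three] using hc
  have hmulN : ∀ x y z, ![x, y, z] ᵥ* N = ![x, y, a * x + (d - a) * y + (d' - d) * z] := by
    intro x y z
    ext i
    fin_cases i <;> simp [N, Matrix.vecMul, dotProduct, Fin.sum_univ_three]
    ring
  obtain ⟨T, hT, h⟩ := (hC.vecMul hN).exists_subfield
    (by simpa [hmulN] using ha) (by simpa [hmulN] using hb)
    (by simpa [hmulN] using hC.smul_mem _ h₂ _ hc)
    (by simpa [hmulN] using hd')
  have hmem : ∀ y z, ![1, y, z] ∈ C ↔ y ∈ T ∧ ∃ s ∈ T, z = a + (d - a) * y + (d' - d) * s := by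
    intro y z
    constructor
    · intro hyz
      have hs : z = a + (d - a) * y + (d' - d) * ((z - a - (d - a) * y) / (d' - d)) := by
        field_simp
        ring
      have := (h y ((z - a - (d - a) * y) / (d' - d))).1 (by
        rw [Set.mem_ofPred_eq, hmulN, mul_one, ← hs]
        exact hyz)
      exact ⟨this.1, _, this.2, hs⟩
    · rintro ⟨hy, s, hs, rfl⟩
      have := (h y s).2 ⟨hy, hs⟩
      rwa [Set.mem_ofPred_eq, hmulN, mul_one] at this
  refine ⟨T, ?_, a, d - a, d' - d, hc, hmem⟩
  symm
  refine Set.eq_of_subset_of_ncard_le ?_ ?_ (Set.toFinite _)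
  · rintro _ ⟨i, rfl⟩
    obtain ⟨z, -, -, hz, -⟩ := hl i
    exact ((hmem _ _).1 hz).1
  · rw [hT, ← Set.image_univ, Set.ncard_image_of_injective _ ht, Set.ncard_univ]
    simp

end Frame

/-! ### Coordinates adapted to the pencil -/

section Coordinates

open Matrix

variable {F : Type*} [Field F]

/-- Coordinates on the plane, adapted to the pencil: the affine points off `linf` are `aff y z`, the
line `l i` is `y = t i`, the lines not through `P₀` are the graphs of affine functions, and the
parameters `t i` form a subfield `T` such that every affine Baer subplane of the family is a plane of
the affine space `T × F` over `T` that contains a direction `(0, c)`. -/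
structure PencilCoordinates (q : ℕ) (P₀ : ℙ F (Fin 3 → F)) (l : Fin q → ℙ F (Fin 3 → F))
    (linf : ℙ F (Fin 3 → F)) (T : Subfield F) (t : Fin q → F) (aff : F → F → ℙ F (Fin 3 → F)) :
    Prop where
  aff_inj : ∀ y z y' z', aff y z = aff y' z' → y = y' ∧ z = z'
  aff_mem : ∀ i y z, aff y z ∈ l i ↔ y = t i
  notMem_linf : ∀ p, p ∉ linf ↔ ∃ y z, p = aff y z
  aff_mem_line : ∀ m : ℙ F (Fin 3 → F), P₀ ∉ m → ∃ α β, ∀ y z, aff y z ∈ m ↔ z = α + β * y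
  t_inj : Function.Injective t
  range_t : Set.range t = T
  aff_mem_baer : ∀ B ∈ baerFamily q l linf, ∃ a b c, c ≠ 0 ∧
    ∀ y z, aff y z ∈ B ↔ y ∈ T ∧ ∃ s ∈ T, z = a + b * y + c * s

variable {q : ℕ} {P₀ : ℙ F (Fin 3 → F)} {l : Fin q → ℙ F (Fin 3 → F)} {linf : ℙ F (Fin 3 → F)}

theorem eq_of_mem_of_mem {x y m n : ℙ F (Fin 3 → F)} (hxy : x ≠ y) (hxm : x ∈ m) (hym : y ∈ m)
    (hxn : x ∈ n) (hyn : y ∈ n) : m = n :=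
  (Configuration.Nondegenerate.eq_or_eq hxm hym hxn hyn).resolve_left hxy

/-- A line with two points of a subplane is a line of that subplane. -/
theorem IsSubplaneOfOrder.mem_of_one_lt_ncard {X Y : Set (ℙ F (Fin 3 → F))}
    (h : IsSubplaneOfOrder q X Y) {m : ℙ F (Fin 3 → F)} (hm : 1 < (X ∩ linePts m).ncard) :
    m ∈ Y := by
  obtain ⟨x, y, hx, hy, hxy⟩ := (Set.one_lt_ncard_iff (Set.finite_of_ncard_pos (by omega))).1 hm
  obtain ⟨n, hn, hxn, hyn⟩ := h.exists_line hx.1 hy.1 hxy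
  rwa [eq_of_mem_of_mem hxy hx.2 hy.2 hxn hyn]

/-- The vertex of the pencil is a point of each subplane of the family, since `l i` and `linf` are
lines of that subplane. -/
theorem vertex_mem_of_mem_baerFamily (hq : 2 ≤ q) (hPl : ∀ i, P₀ ∈ l i) (hPinf : P₀ ∈ linf)
    (hne : ∀ i, l i ≠ linf) {B : Set (ℙ F (Fin 3 → F))} (hB : B ∈ baerFamily q l linf) :
    P₀ ∈ B := by
  obtain ⟨⟨Y, hY⟩, hl, hinf⟩ := hB
  let i : Fin q := ⟨0, by omega⟩
  obtain ⟨x, hxB, hx, hx'⟩ := hY.exists_point (hY.mem_of_one_lt_ncard (by rw [hl i]; omega))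
    (hY.mem_of_one_lt_ncard (by rw [hinf]; omega)) (hne i)
  rwa [(Configuration.Nondegenerate.eq_or_eq (hPl i) hx hPinf hx').resolve_right (hne i)]

theorem vecMul_dotProduct_eq (M : Matrix (Fin 3) (Fin 3) F) (x n : Fin 3 → F) :
    (x ᵥ* M) ⬝ᵥ n = x 0 * (M 0 ⬝ᵥ n) + x 1 * (M 1 ⬝ᵥ n) + x 2 * (M 2 ⬝ᵥ n) := by
  rw [← Matrix.dotProduct_mulVec]
  simp [dotProduct, Matrix.mulVec, Fin.sum_univ_three]

/-- There is a basis in which the pencil consists of `x = 0` and the lines `y = t i * x`, two of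
which are `y = 0` and `y = x`. -/
theorem exists_frame (hPl : ∀ i, P₀ ∈ l i) (hPinf : P₀ ∈ linf)
    (hinj : Function.Injective l) (hne : ∀ i, l i ≠ linf) {i₀ i₁ : Fin q} (hi : i₀ ≠ i₁)
    {R : ℙ F (Fin 3 → F)} (hR : R ∈ l i₀) (hRP : R ≠ P₀)
    {S : ℙ F (Fin 3 → F)} (hS : S ∈ linf) (hSP : S ≠ P₀) :
    ∃ (M : Matrix (Fin 3) (Fin 3) F) (t : Fin q → F), M.det ≠ 0 ∧ Function.Injective t ∧
      t i₀ = 0 ∧ t i₁ = 1 ∧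
      (∀ h : M 2 ≠ 0, mk F (M 2) h = P₀) ∧
      (∀ i x (h : x ᵥ* M ≠ 0), mk F (x ᵥ* M) h ∈ l i ↔ x 1 = t i * x 0) ∧
      (∀ x (h : x ᵥ* M ≠ 0), mk F (x ᵥ* M) h ∈ linf ↔ x 0 = 0) := by
  have hmem : ∀ {p m : ℙ F (Fin 3 → F)}, p ∈ m ↔ p.rep ⬝ᵥ m.rep = 0 := fun {p m} => by
    conv_lhs => rw [← p.mk_rep]
    exact mk_mem_iff_rep _ _
  have hP0 : ∀ i, P₀.rep ⬝ᵥ (l i).rep = 0 := fun i => hmem.1 (hPl i)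
  have hS0 : ∀ i, S.rep ⬝ᵥ (l i).rep ≠ 0 := fun i h =>
    hne i (eq_of_mem_of_mem hSP (hmem.2 h) (hPl i) hS hPinf)
  have hRinf : R.rep ⬝ᵥ linf.rep ≠ 0 := fun h =>
    hne i₀ (eq_of_mem_of_mem hRP hR (hPl _) (hmem.2 h) hPinf)
  have hR0 : ∀ i, R.rep ⬝ᵥ (l i).rep = 0 ↔ i = i₀ := fun i =>
    ⟨fun h => hinj (eq_of_mem_of_mem hRP (hmem.2 h) (hPl i) hR (hPl i₀)),
      fun h => h ▸ hmem.1 hR⟩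
  have hR1 : R.rep ⬝ᵥ (l i₁).rep ≠ 0 := fun h => hi ((hR0 i₁).1 h).symm
  -- The multiple of the vector of `S` is the one that puts `R.rep + c • S.rep` on `l i₁`.
  let c : F := -(R.rep ⬝ᵥ (l i₁).rep) / (S.rep ⬝ᵥ (l i₁).rep)
  have hc : c ≠ 0 := div_ne_zero (neg_ne_zero.2 hR1) (hS0 i₁)
  let M : Matrix (Fin 3) (Fin 3) F := Matrix.of ![R.rep, c • S.rep, P₀.rep]
  let t : Fin q → F := fun i => -(R.rep ⬝ᵥ (l i).rep) / (c * (S.rep ⬝ᵥ (l i).rep))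
  have hli : ∀ i x (h : x ᵥ* M ≠ 0), mk F (x ᵥ* M) h ∈ l i ↔ x 1 = t i * x 0 := by
    intro i x h
    have := hS0 i
    rw [mk_mem_iff_rep, vecMul_dotProduct_eq]
    change x 0 * (R.rep ⬝ᵥ (l i).rep) + x 1 * ((c • S.rep) ⬝ᵥ (l i).rep) +
      x 2 * (P₀.rep ⬝ᵥ (l i).rep) = 0 ↔ _
    rw [hP0, smul_dotProduct, smul_eq_mul]
    have h1 : x 1 = t i * x 0 ↔ x 1 * (c * (S.rep ⬝ᵥ (l i).rep)) = -(R.rep ⬝ᵥ (l i).rep) * x 0 := by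
      simp only [t]
      rw [div_mul_eq_mul_div, eq_div_iff (mul_ne_zero hc this)]
    rw [h1]
    constructor <;> intro h2 <;> linear_combination h2
  have hdet : M.det ≠ 0 := by
    intro h
    obtain ⟨n, hn, h1, h2, h3⟩ := det_rows_eq_zero_iff.1 h
    rw [smul_dotProduct, smul_eq_zero_iff_right hc] at h2
    have hmemn : ∀ {p : ℙ F (Fin 3 → F)}, p.rep ⬝ᵥ n = 0 → p ∈ mk F n hn := fun {p} h => by
      rw [← p.mk_rep, mk_mem_iff]
      exact h
    refine hne i₀ ?_
    rw [eq_of_mem_of_mem hRP hR (hPl i₀) (hmemn h1) (hmemn h3),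
      eq_of_mem_of_mem hSP hS hPinf (hmemn h2) (hmemn h3)]
  refine ⟨M, t, hdet, ?_, ?_, ?_, fun h => P₀.mk_rep, hli, ?_⟩
  · intro i j hij
    have hx : ![1, t i, 0] ᵥ* M ≠ 0 := fun h => hdet
      (Matrix.exists_vecMul_eq_zero_iff.1 ⟨![1, t i, 0], by simp, h⟩)
    refine hinj (eq_of_mem_of_mem (x := mk F _ hx) (y := P₀) ?_ ((hli i _ hx).2 (by simp)) (hPl i)
      ((hli j _ hx).2 (by simp [hij])) (hPl j))
    rintro h
    have h2 : mk F _ hx ∈ linf := h ▸ hPinf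
    rw [mk_mem_iff_rep, vecMul_dotProduct_eq] at h2
    change 1 * (R.rep ⬝ᵥ linf.rep) + t i * ((c • S.rep) ⬝ᵥ linf.rep) + 0 * _ = 0 at h2
    rw [smul_dotProduct, hmem.1 hS] at h2
    simp [hRinf] at h2
  · simp [t, (hR0 i₀).2 rfl]
  · have := hS0 i₁
    simp only [t, c]
    field_simp
  · intro x h
    rw [mk_mem_iff_rep, vecMul_dotProduct_eq]
    change x 0 * (R.rep ⬝ᵥ linf.rep) + x 1 * ((c • S.rep) ⬝ᵥ linf.rep) +
      x 2 * (P₀.rep ⬝ᵥ linf.rep) = 0 ↔ _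
    rw [smul_dotProduct, hmem.1 hS, hmem.1 hPinf]
    simp [hRinf]

/-- A Baer subplane of the family provides the coordinates in which all of the family are affine
planes over the same subfield. -/
theorem exists_pencilCoordinates [Finite F] (hq : 2 ≤ q) (hPl : ∀ i, P₀ ∈ l i) (hPinf : P₀ ∈ linf)
    (hinj : Function.Injective l) (hne : ∀ i, l i ≠ linf) (hB : (baerFamily q l linf).Nonempty) :
    ∃ (T : Subfield F) (t : Fin q → F) (aff : F → F → ℙ F (Fin 3 → F)),
      PencilCoordinates q P₀ l linf T t aff := by
  obtain ⟨B₀, hB₀⟩ := hB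
  let i₀ : Fin q := ⟨0, by omega⟩
  let i₁ : Fin q := ⟨1, by omega⟩
  have hi : i₀ ≠ i₁ := by simp [i₀, i₁]
  obtain ⟨R, hR, hRP⟩ := Set.exists_ne_of_one_lt_ncard
    (show 1 < (B₀ ∩ linePts (l i₀)).ncard by rw [hB₀.2.1]; omega) P₀
  obtain ⟨S, hS, hSP⟩ := Set.exists_ne_of_one_lt_ncard
    (show 1 < (B₀ ∩ linePts linf).ncard by rw [hB₀.2.2]; omega) P₀
  obtain ⟨M, t, hdet, ht, ht₀, ht₁, hMP, hMl, hMinf⟩ :=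
    exists_frame hPl hPinf hinj hne hi hR.2 hRP hS.2 hSP
  have hM0 : ∀ x : Fin 3 → F, x ≠ 0 → x ᵥ* M ≠ 0 := fun x hx h =>
    hdet (Matrix.exists_vecMul_eq_zero_iff.1 ⟨x, hx, h⟩)
  have he2 : ![0, 0, 1] ᵥ* M = M 2 := by
    rw [Matrix.vecMul_eq_sum, Fin.sum_univ_three]
    simp
  have hP : ∀ h, mk F (![0, 0, 1] ᵥ* M) h = P₀ := by
    rw [he2]
    exact hMP
  have hmk : ∀ (x y : Fin 3 → F) (hx : x ᵥ* M ≠ 0) (hy : y ᵥ* M ≠ 0),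
      mk F _ hx = mk F _ hy ↔ ∃ a : F, a • y = x := by
    intro x y hx hy
    rw [mk_eq_mk_iff']
    refine exists_congr fun a => ⟨fun h => ?_, fun h => ?_⟩
    · by_contra h'
      refine hM0 (a • y - x) (sub_ne_zero.2 h') ?_
      rw [Matrix.sub_vecMul, Matrix.smul_vecMul, h, sub_self]
    · rw [← h, Matrix.smul_vecMul]
  have hsurj : ∀ p : ℙ F (Fin 3 → F), ∃ x, ∃ h : x ᵥ* M ≠ 0, p = mk F (x ᵥ* M) h := by
    intro p
    have h : (p.rep ᵥ* M⁻¹) ᵥ* M = p.rep := by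
      rw [Matrix.vecMul_vecMul, Matrix.nonsing_inv_mul _ (isUnit_iff_ne_zero.2 hdet),
        Matrix.vecMul_one]
    have h0 : (p.rep ᵥ* M⁻¹) ᵥ* M ≠ 0 := by rw [h]; exact p.rep_nonzero
    refine ⟨_, h0, ?_⟩
    simp only [h, p.mk_rep]
  have hne0 : ∀ y z : F, ![1, y, z] ≠ 0 := fun y z h => one_ne_zero (congrFun h 0)
  let aff : F → F → ℙ F (Fin 3 → F) := fun y z => mk F (![1, y, z] ᵥ* M) (hM0 _ (hne0 y z))
  have hinf : ∀ p, p ∉ linf ↔ ∃ y z, p = aff y z := by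
    intro p
    obtain ⟨x, hx, rfl⟩ := hsurj p
    rw [hMinf]
    constructor
    · intro h
      refine ⟨(x 0)⁻¹ * x 1, (x 0)⁻¹ * x 2, (hmk _ _ _ _).2 ⟨x 0, ?_⟩⟩
      ext i
      fin_cases i <;> simp [h]
    · rintro ⟨y, z, h⟩
      obtain ⟨a, rfl⟩ := (hmk _ _ _ _).1 h
      intro h0
      have ha : a = 0 := by simpa using h0
      subst ha
      simp at hx
  have hbaer : ∀ B ∈ baerFamily q l linf, ∃ T : Subfield F, (T : Set F) = Set.range t ∧
      ∃ a b c, c ≠ 0 ∧ ∀ y z, aff y z ∈ B ↔ y ∈ T ∧ ∃ s ∈ T, z = a + b * y + c * s := by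
    intro B hB
    obtain ⟨⟨Y, hY⟩, hl, hcinf⟩ := id hB
    have hcone : ∀ {x : Fin 3 → F} (hx : x ᵥ* M ≠ 0),
        x ∈ {x | x ᵥ* M ∈ cone B} ↔ mk F (x ᵥ* M) hx ∈ B :=
      fun hx => ⟨fun h => h.2, fun h => ⟨hx, h⟩⟩
    obtain ⟨S', hS', hSP'⟩ := Set.exists_ne_of_one_lt_ncard
      (show 1 < (B ∩ linePts linf).ncard by rw [hcinf]; omega) P₀
    have hC := hY.isSubplaneCone.vecMul hdet
    obtain ⟨b₀, hb₀⟩ : ∃ b₀, ![0, 1, b₀] ∈ {x | x ᵥ* M ∈ cone B} := by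
      obtain ⟨x, hx, rfl⟩ := hsurj S'
      have hx0 : x 0 = 0 := (hMinf _ _).1 hS'.2
      have hx1 : x 1 ≠ 0 := by
        intro hx1
        apply hSP'
        rw [← hP (hM0 _ (by simp)), hmk]
        refine ⟨x 2, ?_⟩
        ext i
        fin_cases i <;> simp [hx0, hx1]
      refine ⟨(x 1)⁻¹ * x 2, ?_⟩
      convert hC.smul_mem x ((hcone hx).2 hS'.1) (x 1)⁻¹ (inv_ne_zero hx1)
      ext i
      fin_cases i <;> simp [hx0, hx1]
    obtain ⟨T, hT, a, b, c, hc, h⟩ := hC.exists_affine_eq ht ht₀ ht₁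
      ((hcone (hM0 _ (by simp))).2 (by
        rw [hP]; exact vertex_mem_of_mem_baerFamily hq hPl hPinf hne hB)) hb₀ (by
        intro i
        -- Besides `P₀`, the line `l i` has at least two of the `q + 1 ≥ 3` points of `B` on it.
        have h1 : 1 < ((B ∩ linePts (l i)) \ {P₀}).ncard := by
          have := Set.ncard_le_ncard_sdiff_add_ncard (B ∩ linePts (l i)) {P₀}
          rw [hl i, Set.ncard_singleton] at this
          omega
        obtain ⟨x, y, hx, hy, hxy⟩ := (Set.one_lt_ncard_iff (Set.toFinite _)).1 h1
        have hpt : ∀ x ∈ (B ∩ linePts (l i)) \ {P₀}, ∃ z, x = aff (t i) z := by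
          intro x hx
          obtain ⟨y, z, rfl⟩ := (hinf x).1 fun h => hx.2
            ((Configuration.Nondegenerate.eq_or_eq (mem_linePts.1 hx.1.2)
              (hPl i) h hPinf).resolve_right (hne i))
          have : y = t i := by simpa using (hMl i _ _).1 hx.1.2
          exact ⟨z, by rw [this]⟩
        obtain ⟨z, rfl⟩ := hpt x hx
        obtain ⟨z', rfl⟩ := hpt y hy
        exact ⟨z, z', fun h => hxy (by rw [h]), (hcone _).2 hx.1.1, (hcone _).2 hy.1.1⟩)
    exact ⟨T, hT, a, b, c, hc, fun y z => by rw [← h y z, hcone]⟩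
  obtain ⟨T, hT, -⟩ := hbaer B₀ hB₀
  refine ⟨T, t, aff, ⟨?_, ?_, hinf, ?_, ht, hT.symm, ?_⟩⟩
  · intro y z y' z' h
    obtain ⟨a, ha⟩ := (hmk _ _ _ _).1 h
    have h0 := congrFun ha 0
    have h1 := congrFun ha 1
    have h2 := congrFun ha 2
    simp at h0 h1 h2
    subst h0
    simp_all
  · intro i y z
    rw [hMl]
    simp
  · intro m hm
    have hm2 : M 2 ⬝ᵥ m.rep ≠ 0 := by
      rwa [← hP (hM0 _ (by simp)), mk_mem_iff_rep, he2] at hm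
    refine ⟨-(M 0 ⬝ᵥ m.rep) / (M 2 ⬝ᵥ m.rep), -(M 1 ⬝ᵥ m.rep) / (M 2 ⬝ᵥ m.rep), fun y z => ?_⟩
    rw [mk_mem_iff_rep, vecMul_dotProduct_eq]
    simp only [Matrix.cons_val]
    rw [div_mul_eq_mul_div, ← add_div, eq_div_iff hm2]
    constructor <;> intro h <;> linear_combination h
  · intro B hB
    obtain ⟨T', hT', h⟩ := hbaer B hB
    have : T' = T := SetLike.coe_injective (hT'.trans hT.symm)
    rwa [this] at h

end Coordinates

/-! ### Parallel segments and planes of the affine space -/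

section ParallelClass

variable {F : Type*} [Field F] {q : ℕ} {P₀ : ℙ F (Fin 3 → F)}
  {l : Fin q → ℙ F (Fin 3 → F)} {linf : ℙ F (Fin 3 → F)} {T : Subfield F} {t : Fin q → F}
  {aff : F → F → ℙ F (Fin 3 → F)} {A : Fin q → Set (ℙ F (Fin 3 → F))}

/-- Over a subfield of order `q`, a field of order `q ^ 2` has dimension two. -/
theorem exists_eq_add_of_card_eq_sq [Finite F] (hq : Nat.card F = q ^ 2) (hT : Nat.card T = q)
    {c d : F} (hc : c ≠ 0) (h : ∀ s ∈ T, d ≠ c * s) (w : F) :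
    ∃ r ∈ T, ∃ s ∈ T, w = c * r + d * s := by
  let f : T × T → F := fun x => c * x.1 + d * x.2
  have hf : Function.Injective f := by
    rintro ⟨r, s⟩ ⟨r', s'⟩ hrs
    simp only [f] at hrs
    have hs : s = s' := by
      by_contra hs
      have hs0 : (s : F) - s' ≠ 0 := sub_ne_zero.2 fun h => hs (Subtype.ext h)
      refine h ((r' - r) / (s - s')) (T.div_mem (T.sub_mem r'.2 r.2) (T.sub_mem s.2 s'.2)) ?_
      field_simp
      linear_combination hrs
    subst hs
    have : c * (r : F) = c * r' := by linear_combination hrs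
    rw [Subtype.ext (mul_left_cancel₀ hc this)]
  obtain ⟨⟨r, s⟩, hrs⟩ := (hf.bijective_of_nat_card_le
    (by rw [hq, Nat.card_prod, hT, sq])).surjective w
  exact ⟨r, r.2, s, s.2, hrs.symm⟩

theorem PencilCoordinates.nat_card (h : PencilCoordinates q P₀ l linf T t aff) :
    Nat.card T = q := by
  have := Nat.card_range_of_injective h.t_inj
  rw [h.range_t, Nat.card_fin] at this
  exact this

theorem PencilCoordinates.t_mem (h : PencilCoordinates q P₀ l linf T t aff) (i : Fin q) :
    t i ∈ T := by
  rw [← SetLike.mem_coe, ← h.range_t]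
  exact ⟨i, rfl⟩

theorem PencilCoordinates.exists_t_eq (h : PencilCoordinates q P₀ l linf T t aff) {y : F}
    (hy : y ∈ T) : ∃ i, t i = y := by
  rwa [← SetLike.mem_coe, ← h.range_t] at hy

theorem eq_aff_of_mem_affineBaerFamily (h : PencilCoordinates q P₀ l linf T t aff)
    (hA : ∀ j, A j ∈ affineBaerFamily q l linf) {j : Fin q} {p : ℙ F (Fin 3 → F)} (hp : p ∈ A j) :
    ∃ y z, p = aff y z := by
  obtain ⟨B, -, hB⟩ := hA j
  rw [hB] at hp
  exact (h.notMem_linf p).1 hp.2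

/-- The sets `A j` are disjoint planes of `T × F`, each containing the direction `(0, c)`. -/
structure IsParallelClass (T : Subfield F) (aff : F → F → ℙ F (Fin 3 → F))
    (A : Fin q → Set (ℙ F (Fin 3 → F))) (c : F) (a b : Fin q → F) : Prop where
  ne_zero : c ≠ 0
  aff_mem : ∀ j y z, aff y z ∈ A j ↔ y ∈ T ∧ ∃ s ∈ T, z = a j + b j * y + c * s
  disjoint : ∀ i j, i ≠ j → Disjoint (A i) (A j)

/-- Disjoint affine Baer subplanes have the same direction `(0, c)`: two distinct directions span
the line `y = 0`, so that the two planes meet on it. -/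
theorem exists_isParallelClass [Finite F] (h : PencilCoordinates q P₀ l linf T t aff)
    (hq : Nat.card F = q ^ 2) (hq0 : 0 < q) (hA : ∀ j, A j ∈ affineBaerFamily q l linf)
    (hdisj : ∀ i j, i ≠ j → Disjoint (A i) (A j)) :
    ∃ c a b, IsParallelClass T aff A c a b := by
  have hex : ∀ j, ∃ a b c, c ≠ 0 ∧
      ∀ y z, aff y z ∈ A j ↔ y ∈ T ∧ ∃ s ∈ T, z = a + b * y + c * s := by
    intro j
    obtain ⟨B, hB, hAB⟩ := hA j
    obtain ⟨a, b, c, hc, habc⟩ := h.aff_mem_baer B hB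
    refine ⟨a, b, c, hc, fun y z => ?_⟩
    rw [← habc, hAB]
    exact and_iff_left ((h.notMem_linf _).2 ⟨y, z, rfl⟩)
  choose a b c hc hm using hex
  let j₀ : Fin q := ⟨0, hq0⟩
  refine ⟨c j₀, a, b, hc j₀, fun j y z => ?_, hdisj⟩
  have hcj : ∃ e ∈ T, c j = c j₀ * e := by
    by_contra! hne
    have hj : j₀ ≠ j := by
      rintro rfl
      exact hne 1 T.one_mem (mul_one _).symm
    obtain ⟨r, hr, s, hs, hrs⟩ :=
      exists_eq_add_of_card_eq_sq hq h.nat_card (hc j₀) hne (a j - a j₀)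
    have hmem : aff 0 (a j₀ + c j₀ * r) ∈ A j₀ := (hm _ _ _).2 ⟨T.zero_mem, r, hr, by ring⟩
    exact Set.disjoint_left.1 (hdisj _ _ hj) hmem
      ((hm _ _ _).2 ⟨T.zero_mem, -s, T.neg_mem hs, by linear_combination -hrs⟩)
  obtain ⟨e, he, hce⟩ := hcj
  have he0 : e ≠ 0 := by
    rintro rfl
    exact hc j (by rw [hce, mul_zero])
  rw [hm]
  refine and_congr_right fun _ => ⟨?_, ?_⟩
  · rintro ⟨s, hs, rfl⟩
    exact ⟨e * s, T.mul_mem he hs, by rw [hce]; ring⟩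
  · rintro ⟨s, hs, rfl⟩
    refine ⟨s / e, T.div_mem hs he, ?_⟩
    rw [hce]
    field_simp

/-- The affine Baer subplanes `A j` cover the space, by counting. -/
theorem IsParallelClass.exists_mem [Finite F] {c : F} {a b : Fin q → F}
    (hA : IsParallelClass T aff A c a b) (hq : Nat.card F = q ^ 2) (hT : Nat.card T = q)
    {y : F} (hy : y ∈ T) (z : F) :
    ∃ j, aff y z ∈ A j := by
  let f : Fin q × T → F := fun x => a x.1 + b x.1 * y + c * x.2
  have hf : Function.Injective f := by
    rintro ⟨i, r⟩ ⟨j, s⟩ hrs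
    simp only [f] at hrs
    have hij : i = j := by
      by_contra hij
      exact Set.disjoint_left.1 (hA.disjoint _ _ hij)
        ((hA.aff_mem i y _).2 ⟨hy, r, r.2, rfl⟩) ((hA.aff_mem j y _).2 ⟨hy, s, s.2, hrs⟩)
    subst hij
    rw [Subtype.ext (mul_left_cancel₀ hA.ne_zero (add_left_cancel hrs))]
  obtain ⟨⟨j, s⟩, hjs⟩ := (hf.bijective_of_nat_card_le
    (by rw [hq, Nat.card_prod, hT, Nat.card_fin, sq])).surjective z
  exact ⟨j, (hA.aff_mem _ _ _).2 ⟨hy, s, s.2, hjs.symm⟩⟩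

/-- The plane of the affine space `T × F` over `T` through `(0, α)` with directions `(1, β)` and
`(0, c)`. -/
def affinePlane (T : Subfield F) (aff : F → F → ℙ F (Fin 3 → F)) (α β c : F) :
    Set (ℙ F (Fin 3 → F)) :=
  {p | ∃ y ∈ T, ∃ s ∈ T, p = aff y (α + β * y + c * s)}

theorem PencilCoordinates.aff_mem_affinePlane (h : PencilCoordinates q P₀ l linf T t aff)
    {α β c y z : F} :
    aff y z ∈ affinePlane T aff α β c ↔ y ∈ T ∧ ∃ s ∈ T, z = α + β * y + c * s := by
  constructor
  · rintro ⟨y', hy, s, hs, hp⟩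
    obtain ⟨rfl, rfl⟩ := h.aff_inj _ _ _ _ hp
    exact ⟨hy, s, hs, rfl⟩
  · rintro ⟨hy, s, hs, rfl⟩
    exact ⟨y, hy, s, hs, rfl⟩

theorem PencilCoordinates.ncard_affinePlane (h : PencilCoordinates q P₀ l linf T t aff)
    {α β c : F} (hc : c ≠ 0) : (affinePlane T aff α β c).ncard = q ^ 2 := by
  let f : T × T → ℙ F (Fin 3 → F) := fun x => aff x.1 (α + β * x.1 + c * x.2)
  have hf : Function.Injective f := by
    rintro ⟨y, s⟩ ⟨y', s'⟩ hp
    obtain ⟨h1, h2⟩ := h.aff_inj _ _ _ _ hp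
    obtain rfl := Subtype.ext h1
    exact congrArg (Prod.mk y) (Subtype.ext (mul_left_cancel₀ hc (add_left_cancel h2)))
  have : affinePlane T aff α β c = Set.range f := by
    ext p
    constructor
    · rintro ⟨y, hy, s, hs, rfl⟩
      exact ⟨(⟨y, hy⟩, ⟨s, hs⟩), rfl⟩
    · rintro ⟨⟨y, s⟩, rfl⟩
      exact ⟨y, y.2, s, s.2, rfl⟩
  rw [this, ← Nat.card_coe_set_eq, Nat.card_range_of_injective hf, Nat.card_prod, h.nat_card, sq]

/-- The plane contains every line of `Λ` that meets it twice: the direction `(0, c')` of a segment on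
`l i`, or `(1, β')` of a transversal one, is in the direction space because `T` has inverses. -/
theorem isSpaceFlat_affinePlane (h : PencilCoordinates q P₀ l linf T t aff)
    (hPinf : P₀ ∈ linf) (hPl : ∀ i, P₀ ∈ l i) (hne : ∀ i, l i ≠ linf) {α β c : F} :
    IsSpaceFlat q P₀ l linf (affinePlane T aff α β c) := by
  refine ⟨?_, ?_⟩
  · rintro _ ⟨y, hy, s, -, rfl⟩
    obtain ⟨i, rfl⟩ := h.exists_t_eq hy
    refine ⟨Set.mem_iUnion.2 ⟨i, (h.aff_mem i _ _).2 rfl⟩, ?_⟩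
    rintro hP
    exact (h.notMem_linf _).2 ⟨_, _, rfl⟩ (Set.mem_singleton_iff.1 hP ▸ hPinf)
  rintro S (hS | ⟨m, hPm, rfl⟩) p ⟨hpS, hp⟩ p' ⟨hpS', hp'⟩ hpp
  · obtain ⟨i, A', ⟨B, hB, rfl⟩, rfl⟩ := Set.mem_iUnion.1 hS
    obtain ⟨a', b', c', hc', hmem⟩ := h.aff_mem_baer B hB
    obtain ⟨y, hy, s, hs, rfl⟩ := hp
    obtain ⟨y', hy', s', hs', rfl⟩ := hp'
    obtain rfl := (h.aff_mem i _ _).1 hpS.2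
    obtain rfl := (h.aff_mem i _ _).1 hpS'.2
    obtain ⟨-, u, hu, hu'⟩ := (hmem _ _).1 hpS.1.1
    obtain ⟨-, v, hv, hv'⟩ := (hmem _ _).1 hpS'.1.1
    have huv : u - v ≠ 0 := by
      intro huv
      apply hpp
      rw [hu', hv', sub_eq_zero.1 huv]
    have hcc : c' = c * ((s - s') / (u - v)) := by
      field_simp
      linear_combination hv' - hu'
    rintro x ⟨⟨hxB, hxinf⟩, hxi⟩
    obtain ⟨y, z, rfl⟩ := (h.notMem_linf x).1 hxinf
    obtain rfl := (h.aff_mem i _ _).1 hxi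
    obtain ⟨-, w, hw, rfl⟩ := (hmem _ _).1 hxB
    refine h.aff_mem_affinePlane.2 ⟨hy, s + (s - s') / (u - v) * (w - u),
      T.add_mem hs (T.mul_mem (T.div_mem (T.sub_mem hs hs') (T.sub_mem hu hv)) (T.sub_mem hw hu)),
      ?_⟩
    linear_combination (w - u) * hcc - hu'
  · obtain ⟨α', β', hm⟩ := h.aff_mem_line m hPm
    obtain ⟨y, hy, s, hs, rfl⟩ := hp
    obtain ⟨y', hy', s', hs', rfl⟩ := hp'
    have h1 := (hm _ _).1 hpS.1
    have h2 := (hm _ _).1 hpS'.1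
    have hyy : y - y' ≠ 0 := by
      intro hyy
      apply hpp
      rw [h1, h2, sub_eq_zero.1 hyy]
    have hβ : β' = β + c * ((s - s') / (y - y')) := by
      field_simp
      linear_combination h2 - h1
    rintro x ⟨hxm, hx⟩
    obtain ⟨i, hi⟩ := Set.mem_iUnion.1 hx
    obtain ⟨y₁, z₁, rfl⟩ := (h.notMem_linf x).1 fun hxinf => hPm (by
      rwa [← (Configuration.Nondegenerate.eq_or_eq (mem_linePts.1 hi) (hPl i) hxinf
        hPinf).resolve_right (hne i)])
    obtain rfl := (h.aff_mem i _ _).1 hi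
    have h3 := (hm _ _).1 hxm
    refine h.aff_mem_affinePlane.2 ⟨h.t_mem i, s + (s - s') / (y - y') * (t i - y),
      T.add_mem hs (T.mul_mem (T.div_mem (T.sub_mem hs hs') (T.sub_mem hy hy'))
        (T.sub_mem (h.t_mem i) hy)), ?_⟩
    linear_combination h3 - h1 + (t i - y) * hβ

/-- Distinct members of `𝒮` are disjoint. -/
theorem eq_of_mem_of_mem_thetaPoints (h : PencilCoordinates q P₀ l linf T t aff)
    (hA : ∀ j, A j ∈ affineBaerFamily q l linf)
    (hdisj : ∀ i j, i ≠ j → Disjoint (A i) (A j)) {s s' : Set (ℙ F (Fin 3 → F))}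
    (hs : s ∈ thetaPoints l A) (hs' : s' ∈ thetaPoints l A) {p : ℙ F (Fin 3 → F)}
    (hp : p ∈ s) (hp' : p ∈ s') : s = s' := by
  obtain ⟨i, j, rfl⟩ := hs
  obtain ⟨i', j', rfl⟩ := hs'
  obtain ⟨y, z, rfl⟩ := eq_aff_of_mem_affineBaerFamily h hA hp.2
  obtain rfl : i = i' :=
    h.t_inj (((h.aff_mem _ _ _).1 hp.1).symm.trans ((h.aff_mem _ _ _).1 hp'.1))
  obtain rfl : j = j' := by
    by_contra hj
    exact Set.disjoint_left.1 (hdisj _ _ hj) hp.2 hp'.2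
  rfl

theorem ncard_of_mem_thetaPoints (h : PencilCoordinates q P₀ l linf T t aff)
    (hA : ∀ j, A j ∈ affineBaerFamily q l linf) {c : F} {a b : Fin q → F}
    (hpar : IsParallelClass T aff A c a b) {s : Set (ℙ F (Fin 3 → F))}
    (hs : s ∈ thetaPoints l A) : s.ncard = q := by
  obtain ⟨i, j, rfl⟩ := hs
  let f : T → ℙ F (Fin 3 → F) := fun s => aff (t i) (a j + b j * t i + c * s)
  have hf : Function.Injective f := fun s s' hss =>
    Subtype.ext (mul_left_cancel₀ hpar.ne_zero (add_left_cancel (h.aff_inj _ _ _ _ hss).2))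
  have : linePts (l i) ∩ A j = Set.range f := by
    ext p
    constructor
    · rintro ⟨hpl, hpA⟩
      obtain ⟨y, z, rfl⟩ := eq_aff_of_mem_affineBaerFamily h hA hpA
      obtain rfl := (h.aff_mem i _ _).1 hpl
      obtain ⟨-, s, hs, rfl⟩ := (hpar.aff_mem _ _ _).1 hpA
      exact ⟨⟨s, hs⟩, rfl⟩
    · rintro ⟨s, rfl⟩
      exact ⟨(h.aff_mem _ _ _).2 rfl, (hpar.aff_mem _ _ _).2 ⟨h.t_mem i, s, s.2, rfl⟩⟩
  rw [this, ← Nat.card_coe_set_eq, Nat.card_range_of_injective hf, h.nat_card]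

/-- A segment of `𝒮` that meets the line `z = α + β * y` is contained in the plane spanned by this
line and the direction of `𝒮`. -/
theorem subset_affinePlane_of_mem (h : PencilCoordinates q P₀ l linf T t aff)
    (hA : ∀ j, A j ∈ affineBaerFamily q l linf) {c : F} {a b : Fin q → F}
    (hpar : IsParallelClass T aff A c a b) {s : Set (ℙ F (Fin 3 → F))}
    (hs : s ∈ thetaPoints l A) {α β y : F} (hy : aff y (α + β * y) ∈ s) :
    s ⊆ affinePlane T aff α β c := by
  obtain ⟨i, j, rfl⟩ := hs
  obtain rfl := (h.aff_mem i _ _).1 hy.1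
  obtain ⟨-, u, hu, hu'⟩ := (hpar.aff_mem _ _ _).1 hy.2
  rintro p ⟨hpl, hpA⟩
  obtain ⟨y, z, rfl⟩ := eq_aff_of_mem_affineBaerFamily h hA hpA
  obtain rfl := (h.aff_mem i _ _).1 hpl
  obtain ⟨-, v, hv, rfl⟩ := (hpar.aff_mem _ _ _).1 hpA
  refine h.aff_mem_affinePlane.2 ⟨h.t_mem i, v - u, T.sub_mem hv hu, ?_⟩
  linear_combination -hu'

/-- The segments of `𝒮` in the plane spanned by a transversal line and the direction of `𝒮` form a
line of `Θ(𝒮)`: there is exactly one of them on each line `l i`. -/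
theorem setOf_subset_affinePlane_mem_thetaLines [Finite F]
    (h : PencilCoordinates q P₀ l linf T t aff)
    (hq : Nat.card F = q ^ 2) (hPinf : P₀ ∈ linf) (hPl : ∀ i, P₀ ∈ l i) (hne : ∀ i, l i ≠ linf)
    (hA : ∀ j, A j ∈ affineBaerFamily q l linf) {c : F} {a b : Fin q → F}
    (hpar : IsParallelClass T aff A c a b) (α β : F) :
    {s | s ∈ thetaPoints l A ∧ s ⊆ affinePlane T aff α β c} ∈ thetaLines q P₀ l linf A := by
  refine ⟨_, isSpaceFlat_affinePlane h hPinf hPl hne,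
    h.ncard_affinePlane hpar.ne_zero, rfl, ?_⟩
  choose j hj using fun i => hpar.exists_mem hq h.nat_card (h.t_mem i) (α + β * t i)
  have hmem : ∀ i, aff (t i) (α + β * t i) ∈ linePts (l i) ∩ A (j i) := fun i =>
    ⟨(h.aff_mem _ _ _).2 rfl, hj i⟩
  have hinj : Function.Injective fun i => linePts (l i) ∩ A (j i) := by
    intro i i' hii
    have := hmem i
    simp only at hii
    rw [hii] at this
    exact h.t_inj ((h.aff_mem _ _ _).1 this.1)
  have : {s | s ∈ thetaPoints l A ∧ s ⊆ affinePlane T aff α β c} =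
      Set.range fun i => linePts (l i) ∩ A (j i) := by
    ext s
    constructor
    · rintro ⟨⟨i, k, rfl⟩, hs⟩
      refine ⟨i, eq_of_mem_of_mem_thetaPoints h hA hpar.disjoint ⟨_, _, rfl⟩ ⟨_, _, rfl⟩ (hmem i)
        ⟨(hmem i).1, ?_⟩⟩
      have hk : aff (t i) (a k + b k * t i) ∈ linePts (l i) ∩ A k :=
        ⟨(h.aff_mem _ _ _).2 rfl, (hpar.aff_mem _ _ _).2 ⟨h.t_mem i, 0, T.zero_mem, by ring⟩⟩
      obtain ⟨-, u, hu, hu'⟩ := h.aff_mem_affinePlane.1 (hs hk)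
      exact (hpar.aff_mem _ _ _).2 ⟨h.t_mem i, -u, T.neg_mem hu, by linear_combination -hu'⟩
    · rintro ⟨i, rfl⟩
      exact ⟨⟨i, _, rfl⟩, subset_affinePlane_of_mem h hA hpar ⟨i, _, rfl⟩ (hmem i)⟩
  rw [this, ← Nat.card_coe_set_eq, Nat.card_range_of_injective hinj, Nat.card_fin]

theorem ncard_sUnion_of_ncard_eq {α : Type*} [Finite α] {K : Set (Set α)} {n : ℕ}
    (hn : ∀ s ∈ K, s.ncard = n) (hdisj : ∀ s ∈ K, ∀ s' ∈ K, ∀ x ∈ s, x ∈ s' → s = s') :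
    (⋃₀ K).ncard = K.ncard * n := by
  have hK := Set.toFinite K
  rw [Set.sUnion_eq_biUnion, hK.ncard_biUnion (fun _ _ => Set.toFinite _) ?_,
    finsum_mem_congr rfl hn, finsum_mem_eq_finite_toFinset_sum _ hK, Finset.sum_const,
    Set.ncard_eq_toFinset_card K hK, smul_eq_mul]
  intro s hs s' hs' hss
  exact Set.disjoint_left.2 fun x hx hx' => hss (hdisj s hs s' hs' x hx hx')

theorem exists_line_of_not_independent {f : Fin 3 → ℙ F (Fin 3 → F)} (hf : ¬ Independent f) :
    ∃ m : ℙ F (Fin 3 → F), ∀ i, f i ∈ m := by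
  rw [independent_iff] at hf
  have hdet : (Matrix.of fun i => (f i).rep).det = 0 := by
    by_contra hdet
    exact hf (Matrix.linearIndependent_rows_iff_isUnit.2
      ((Matrix.isUnit_iff_isUnit_det _).2 (isUnit_iff_ne_zero.2 hdet)))
  obtain ⟨n, hn, h⟩ := Matrix.exists_mulVec_eq_zero_iff.2 hdet
  refine ⟨mk F n hn, fun i => ?_⟩
  rw [← (f i).mk_rep, mk_mem_iff]
  exact congrFun h i

theorem isIndepSet_two (S : Set (ℙ F (Fin 3 → F))) : IsIndepSet 2 S := by
  intro f hf _
  have : f = ![f 0, f 1] := by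
    ext i
    fin_cases i <;> rfl
  rw [this, independent_pair_iff_ne]
  exact hf.ne (by decide)

end ParallelClass

end BaerParc

theorem theorem5p1 {F : Type*} [Field F] [Fintype F] (q : ℕ) (hq : Fintype.card F = q ^ 2)
    (X : Set (ℙ F (Fin 3 → F))) (Y : Set (ℙ F (Fin 3 → F))) (P₀ : ℙ F (Fin 3 → F))
    (l : Fin q → ℙ F (Fin 3 → F)) (linf : ℙ F (Fin 3 → F))
    (hpencil : BaerParc.IsSubplanePencil q X Y P₀ l linf)
    (A : Fin q → Set (ℙ F (Fin 3 → F)))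
    (hA : ∀ j, A j ∈ BaerParc.affineBaerFamily q l linf)
    (hdisj : ∀ i j, i ≠ j → Disjoint (A i) (A j))
    (k : ℕ) (K : Set (Set (ℙ F (Fin 3 → F))))
    (hK : BaerParc.IsPlaneArc (BaerParc.thetaPoints l A)
      (BaerParc.thetaLines q P₀ l linf A) k K) :
    BaerParc.IsPencilArc P₀ (k * q) (⋃₀ K) := by
  open BaerParc in
  have hq2 : 2 ≤ q := by
    have := Fintype.one_lt_card (α := F)
    by_contra hlt
    have : q ^ 2 ≤ 1 := pow_le_one₀ (Nat.zero_le q) (by omega)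
    omega
  have hcard : Nat.card F = q ^ 2 := by rw [Nat.card_eq_fintype_card, hq]
  have hmem : ∀ m, m ∈ insert linf (Set.range l) → P₀ ∈ m := fun m hm => by
    rw [← hpencil.pencil] at hm
    exact hm.2
  have hPl : ∀ i, P₀ ∈ l i := fun i => hmem _ (Or.inr ⟨i, rfl⟩)
  have hPinf : P₀ ∈ linf := hmem _ (Or.inl rfl)
  have hne := hpencil.linf_ne
  obtain ⟨B, hB, -⟩ := hA ⟨0, by omega⟩
  obtain ⟨T, t, aff, h⟩ := exists_pencilCoordinates hq2 hPl hPinf hpencil.injective hne ⟨B, hB⟩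
  obtain ⟨c, a, b, hpar⟩ := exists_isParallelClass h hcard (by omega) hA hdisj
  obtain ⟨hKS, hKk, harc⟩ := hK
  have haff : ∀ p ∈ ⋃₀ K, ∃ y z, p = aff y z := by
    rintro p ⟨s, hs, hp⟩
    obtain ⟨i, j, rfl⟩ := hKS hs
    exact eq_aff_of_mem_affineBaerFamily h hA hp.2
  have heq : ∀ s ∈ K, ∀ s' ∈ K, ∀ p ∈ s, p ∈ s' → s = s' := fun s hs s' hs' p hp hp' =>
    eq_of_mem_of_mem_thetaPoints h hA hdisj (hKS hs) (hKS hs') hp hp'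
  refine ⟨?_, fun m _ => isIndepSet_two _, ?_, ?_⟩
  · rw [ncard_sUnion_of_ncard_eq (fun s hs => ncard_of_mem_thetaPoints h hA hpar (hKS hs)) heq, hKk]
  · -- Two lines of the pencil meet only in `P₀`, which is on `linf`.
    intro m n hm hn hmn
    refine Set.eq_empty_of_forall_notMem ?_
    rintro p ⟨⟨hpK, hpm⟩, hpn⟩
    refine (h.notMem_linf p).2 (haff p hpK) ?_
    rwa [(Configuration.Nondegenerate.eq_or_eq (mem_linePts.1 hpm) hm hpn hn).resolve_right hmn]
  · intro f hf hfK hnot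
    by_contra hdep
    obtain ⟨m, hm⟩ := exists_line_of_not_independent hdep
    have hPm : P₀ ∉ m := fun hPm => hnot ⟨m, hPm, hm⟩
    obtain ⟨α, β, hαβ⟩ := h.aff_mem_line m hPm
    have hfy : ∀ i, ∃ y, f i = aff y (α + β * y) := by
      intro i
      obtain ⟨y, z, hyz⟩ := haff _ (hfK i)
      have hmi := hm i
      rw [hyz, hαβ] at hmi
      exact ⟨y, by rw [hyz, hmi]⟩
    choose y hy using hfy
    choose s hs hfs using hfK
    have hsub : ∀ i, s i ∈ thetaPoints l A ∧ s i ⊆ affinePlane T aff α β c := fun i =>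
      ⟨hKS (hs i), subset_affinePlane_of_mem h hA hpar (hKS (hs i)) (hy i ▸ hfs i)⟩
    -- Each segment lies on a line of the pencil, which meets `m` only once.
    have hinj : ∀ i j, i ≠ j → s i ≠ s j := by
      intro i j hij hsij
      obtain ⟨e, e', he⟩ := hKS (hs i)
      have hi := hfs i
      have hj := hfs j
      rw [← hsij] at hj
      rw [he, hy] at hi hj
      have hyij : y i = y j := ((h.aff_mem _ _ _).1 hi.1).trans ((h.aff_mem _ _ _).1 hj.1).symm
      exact hij (hf (by rw [hy, hy, hyij]))
    exact harc _ (hs 0) _ (hs 1) _ (hs 2) (hinj 0 1 (by decide)) (hinj 0 2 (by decide))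
      (hinj 1 2 (by decide)) _
      (setOf_subset_affinePlane_mem_thetaLines h hcard hPinf hPl hne hA hpar α β)
      ⟨hsub 0, hsub 1, hsub 2⟩
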